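/- Let $L>0$ and $D\in(0,L]$. For an integer $n\ge 2$ with $nD>L$ let $\mathcal S_n=\mathcal S(L,D,n)$ be the star graph consisting of one distinguished edge $e_0$ of length $(nD-L)/(n-1)$ and $n$ edges of length $(L-D)/(n-1)$, all joined at one common vertex; its total length is $L$ and the distance from the free end $v_0$ of $e_0$ to the end of each other edge is $D$ (the diameter of $\mathcal S_n$ is $D$ as soon as $e_0$ is at least as long as the other edges, in particular for all large $n$; for $D=L$ the star degenerates to an interval of length $L$). Let $\lambda_1(\mathcal S_n)$ be the smallest eigenvalue of the Laplacian on $\mathcal S_n$ with a Dirichlet condition at $v_0$ and natural (continuity and Kirchhoff) conditions at all other vertices, i.e. of the operator associated with the form $\int_{\mathcal S_n} f'g'\,dx$ on $\{f\in H^1(\mathcal S_n): f(v_0)=0\}$. This smallest eigenvalue exists, and the equation $$\cos(\omega D)=\omega(L-D)\sin(\omega D)$$ has a smallest positive solution $\omega=\omega(L,D)$. Moreover: 1. If $D<L$, then $\lambda_1(\mathcal S_n)$ is strictly decreasing in $n$ (over all $n\ge2$ with $nD>L$) and $\lambda_1(\mathcal S_n)>\omega^2$ for each such $n$; if $D=L$,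 then $\lambda_1(\mathcal S_n)=\omega^2$ for all $n\ge 2$. In both cases $\lambda_1(\mathcal S_n)\to\omega^2$ as $n\to\infty$. 2. The number $\omega^2$ is the smallest real eigenvalue (in particular the smallest positive one) of the problem $-u''=\omega^2u$ in $(0,D)$, $u(0)=0$, $u''(D)+\frac{1}{L-D}u'(D)=0$ with $u\in C^2([0,D])$, where for $D=L$ the last condition is read as $u'(D)=0$. 3. For fixed $L$, $\omega^2$ is a strictly decreasing function of $D\in(0,L]$. 4. We have $$\frac1{LD}<\frac{1}{LD-\frac{D^2}{2}}\le\omega^2\le\frac{3}{3LD-2D^2}\qquad\text{and}\qquad \omega^2<\frac3{LD},$$ and $\frac{3}{3LD-2D^2}<\frac{3}{LD}$ if $D<L$. -/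

import Mathlib

open MeasureTheory

/-- A metric graph with vertex set `V` and edge set `E`: the edge `e` is identified with the
interval `[0, len e]`, its end `0` being the vertex `src e` and its end `len e` being the
vertex `tgt e`. Edges of length zero are allowed; they only identify their two end vertices. -/
structure MetricGraph (V E : Type) where
  src : E → V
  tgt : E → V
  len : E → NNReal

namespace MetricGraph

variable {V E : Type}

/-- `f` is the (continuous representative of an) element of `H¹₀(G)`, the space of `H¹` functions
on `G` vanishing on the set `VD` of Dirichlet vertices, and `f'` is its derivative: on every edge
`f'` is square integrable and `f` is a primitive of `f'` (i.e. `f` is in `H¹` of the edge, with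
weak derivative `f'`), the values of `f` at the ends of the edges come from one function `φ` on the
vertices (continuity at the vertices), and `φ` is zero on `VD`. -/
def IsH10 (G : MetricGraph V E) (VD : Set V) (f f' : E → ℝ → ℝ) : Prop :=
  (∀ e, MemLp (f' e) 2 (volume.restrict (Set.Icc (0 : ℝ) (G.len e)))) ∧
  (∀ e, ∀ x ∈ Set.Icc (0 : ℝ) (G.len e), f e x = f e 0 + ∫ t in (0 : ℝ)..x, f' e t) ∧
  ∃ φ : V → ℝ,
    (∀ e, f e 0 = φ (G.src e) ∧ f e (G.len e) = φ (G.tgt e)) ∧ ∀ v ∈ VD, φ v = 0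

/-- The integral of `f * g` over the graph. -/
noncomputable def inner [Fintype E] (G : MetricGraph V E) (f g : E → ℝ → ℝ) : ℝ :=
  ∑ e, ∫ x in (0 : ℝ)..(G.len e), f e x * g e x

/-- `μ` is an eigenvalue of the Laplacian on `G` with Dirichlet conditions on `VD` and natural
(continuity and Kirchhoff) conditions at all other vertices, that is, of the operator associated
with the form `a(f, g) = ∫ f' g'` on `H¹₀(G)`: there is a nonzero `f ∈ H¹₀(G)` with
`a(f, g) = μ ∫ f g` for all `g ∈ H¹₀(G)`. -/
def IsEigenvalue [Fintype E] (G : MetricGraph V E) (VD : Set V) (μ : ℝ) : Prop :=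
  ∃ f f' : E → ℝ → ℝ, G.IsH10 VD f f' ∧ 0 < G.inner f f ∧
    ∀ g g' : E → ℝ → ℝ, G.IsH10 VD g g' → G.inner f' g' = μ * G.inner f g

end MetricGraph

/-- The vertices of a star: the far end `v₀` of the distinguished edge, the centre, and the
`n` far ends of the other edges. -/
inductive StarVertex (n : ℕ) : Type where
  | v₀ : StarVertex n
  | center : StarVertex n
  | leaf : Fin n → StarVertex n

/-- The star `S(L, D, n)`: a distinguished edge `none` of length `(n D - L) / (n - 1)` from `v₀` to
the centre and `n` edges `some i` of length `(L - D) / (n - 1)` from the centre to the leaves.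
(The truncation `Real.toNNReal` has no effect for `n ≥ 2` and `0 < D ≤ L ≤ n D`.) -/
noncomputable def starGraph (L D : ℝ) (n : ℕ) : MetricGraph (StarVertex n) (Option (Fin n)) where
  src
    | none => StarVertex.v₀
    | some _ => StarVertex.center
  tgt
    | none => StarVertex.center
    | some i => StarVertex.leaf i
  len
    | none => Real.toNNReal ((n * D - L) / (n - 1))
    | some _ => Real.toNNReal ((L - D) / (n - 1))

/-- The eigenvalues of the star with a Dirichlet condition at `v₀` and natural conditions at all
other vertices. -/
def starEigenvalues (L D : ℝ) (n : ℕ) : Set ℝ :=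
  {μ | (starGraph L D n).IsEigenvalue {StarVertex.v₀} μ}

/-- The smallest eigenvalue of the star. -/
noncomputable def starFirstEigenvalue (L D : ℝ) (n : ℕ) : ℝ := sInf (starEigenvalues L D n)

/-- The positive solutions of `cos (ω D) = ω (L - D) sin (ω D)`. -/
def limitRoots (L D : ℝ) : Set ℝ :=
  {w | 0 < w ∧ Real.cos (w * D) = w * (L - D) * Real.sin (w * D)}

/-- The smallest positive solution of `cos (ω D) = ω (L - D) sin (ω D)`. -/
noncomputable def limitRoot (L D : ℝ) : ℝ := sInf (limitRoots L D)

/-- The real eigenvalues of the problem `-u'' = μ u` in `(0, D)`, `u(0) = 0`,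
`u''(D) + (L - D)⁻¹ u'(D) = 0`, where `u` is in `C²([0, D])`. The condition at `D` is multiplied
by `L - D`, so that it also makes sense for `D = L`, when it is the Neumann condition. -/
def wentzellEigenvalues (L D : ℝ) : Set ℝ :=
  {μ | ∃ u u' u'' : ℝ → ℝ,
    (∀ x ∈ Set.Icc 0 D, HasDerivWithinAt u (u' x) (Set.Icc 0 D) x) ∧
    (∀ x ∈ Set.Icc 0 D, HasDerivWithinAt u' (u'' x) (Set.Icc 0 D) x) ∧
    ContinuousOn u'' (Set.Icc 0 D) ∧
    (∃ x ∈ Set.Icc 0 D, u x ≠ 0) ∧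
    (∀ x ∈ Set.Ioo 0 D, -u'' x = μ * u x) ∧
    u 0 = 0 ∧
    (L - D) * u'' D + u' D = 0}

/-! Let `a` be the length of the distinguished edge and `b = D - a` that of the others. The function
equal to a multiple of `sin (k x)` on the long edge and of `cos (k (b - x))` on the others satisfies
the Kirchhoff condition at the centre exactly when `cot (k a) = n tan (k b)`, that is, when
`starSecular` vanishes at `k`. For a zero with `k D ≤ π / 2`, `k ^ 2` is an eigenvalue. It is the
smallest one by Picone's inequality on each edge (`cot_le`, `tan_le`): the boundary terms at the
centre cancel, leaving `k² ∫ f² ≤ ∫ f'²` for every admissible `f`. This needs no regularity of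
eigenfunctions.

On `[0, π / (2 D)]` both `starSecular` and `limitSecular` strictly decrease from `1` to a value that
is at most `0`, so each has a single zero there, and comparing zeros amounts to reading off the sign
of one function at the zero of another. For `D < L`, the star functions decrease in `n` to the limit
function, because `(n - 1) sin (k (L - D) / (n - 1))` increases to `k (L - D)` and `a` increases to
`D`. Similarly `limitSecular` decreases in `D`.

The solutions of the interval problem are multiples of `sin (k x)`, and the condition at `D` is then
the limit equation. The explicit bounds come from `1 - t² / 2 ≤ t cot t ≤ 1 - t² / 3` at `t = ω D`.
-/

/-! ### Sharp Dirichlet integral inequalities on one edge. -/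

/-- `f` is, on `[0, ℓ]`, a primitive of the integrable function `f'`. -/
def IsPrimitiveOn (f f' : ℝ → ℝ) (ℓ : ℝ) : Prop :=
  IntervalIntegrable f' volume 0 ℓ ∧ ∀ x ∈ Set.Icc 0 ℓ, f x = f 0 + ∫ t in (0 : ℝ)..x, f' t

namespace IsPrimitiveOn

variable {f f' g g' : ℝ → ℝ} {ℓ : ℝ}

theorem mono (hf : IsPrimitiveOn f f' ℓ) {x : ℝ} (hx : x ∈ Set.Icc 0 ℓ) :
    IsPrimitiveOn f f' x :=
  ⟨hf.1.mono_set (by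
      rw [Set.uIcc_of_le hx.1, Set.uIcc_of_le (hx.1.trans hx.2)]
      exact Set.Icc_subset_Icc_right hx.2),
    fun y hy => hf.2 y ⟨hy.1, hy.2.trans hx.2⟩⟩

theorem of_hasDerivAt (hℓ : 0 ≤ ℓ) (h : ∀ x ∈ Set.Icc 0 ℓ, HasDerivAt f (f' x) x)
    (hc : ContinuousOn f' (Set.Icc 0 ℓ)) : IsPrimitiveOn f f' ℓ := by
  have hint : IntervalIntegrable f' volume 0 ℓ := hc.intervalIntegrable_of_Icc hℓ
  refine ⟨hint, fun x hx => ?_⟩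
  rw [intervalIntegral.integral_eq_sub_of_hasDerivAt (f := f)]
  · ring
  · intro y hy
    rw [Set.uIcc_of_le hx.1] at hy
    exact h y ⟨hy.1, hy.2.trans hx.2⟩
  · exact (hc.mono (Set.Icc_subset_Icc_right hx.2)).intervalIntegrable_of_Icc hx.1

/-- Stated for the primitive itself, whose derivative is known almost everywhere; `f` agrees with it
on `[0, ℓ]`. -/
theorem absolutelyContinuous (hf : IsPrimitiveOn f f' ℓ) :
    AbsolutelyContinuousOnInterval (fun x => f 0 + ∫ t in (0 : ℝ)..x, f' t) 0 ℓ := by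
  have h := hf.1.absolutelyContinuousOnInterval_intervalIntegral (c := 0) (by simp)
  have hc : AbsolutelyContinuousOnInterval (fun _ : ℝ => f 0) 0 ℓ :=
    (LipschitzWith.const (f 0)).lipschitzOnWith.absolutelyContinuousOnInterval
  exact hc.add h

theorem continuousOn (hℓ : 0 ≤ ℓ) (hf : IsPrimitiveOn f f' ℓ) :
    ContinuousOn f (Set.Icc 0 ℓ) := by
  have h := hf.absolutelyContinuous.continuousOn
  rw [Set.uIcc_of_le hℓ] at h
  exact h.congr hf.2

/-- Integration by parts. -/
theorem integral_mul_add (hℓ : 0 ≤ ℓ) (hf : IsPrimitiveOn f f' ℓ) (hg : IsPrimitiveOn g g' ℓ) :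
    ∫ x in (0 : ℝ)..ℓ, (f' x * g x + f x * g' x) = f ℓ * g ℓ - f 0 * g 0 := by
  have h := hf.absolutelyContinuous.integral_deriv_mul_eq_sub hg.absolutelyContinuous
  rw [← hf.2 ℓ ⟨hℓ, le_rfl⟩, ← hg.2 ℓ ⟨hℓ, le_rfl⟩] at h
  simp only [intervalIntegral.integral_same, add_zero] at h
  rw [← h]
  apply intervalIntegral.integral_congr_ae
  filter_upwards [hf.1.ae_hasDerivAt_integral, hg.1.ae_hasDerivAt_integral] with x h1 h2 hx
  have hx' := Set.uIoc_subset_uIcc hx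
  have h1' := ((h1 hx' 0 (by simp)).const_add (f 0)).deriv
  have h2' := ((h2 hx' 0 (by simp)).const_add (g 0)).deriv
  rw [Set.uIcc_of_le hℓ] at hx'
  rw [h1', h2', ← hf.2 x hx', ← hg.2 x hx']

theorem mul (hℓ : 0 ≤ ℓ) (hf : IsPrimitiveOn f f' ℓ) (hg : IsPrimitiveOn g g' ℓ) :
    IsPrimitiveOn (fun x => f x * g x) (fun x => f' x * g x + f x * g' x) ℓ := by
  have cf := hf.continuousOn hℓ
  have cg := hg.continuousOn hℓ
  rw [← Set.uIcc_of_le hℓ] at cf cg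
  refine ⟨(hf.1.mul_continuousOn cg).add (hg.1.continuousOn_mul cf), fun x hx => ?_⟩
  rw [(hf.mono hx).integral_mul_add hx.1 (hg.mono hx)]
  ring

/-- Picone's inequality: a solution `w` of the Riccati equation `w' + w² = -κ²` bounds the
Dirichlet integral from below. -/
theorem riccati_le (hℓ : 0 ≤ ℓ) (hf : IsPrimitiveOn f f' ℓ)
    (hL2 : IntervalIntegrable (fun x => f' x ^ 2) volume 0 ℓ) {w w' : ℝ → ℝ} {κ : ℝ}
    (hw : ∀ x ∈ Set.Icc 0 ℓ, HasDerivAt w (w' x) x)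
    (hric : ∀ x ∈ Set.Icc 0 ℓ, w' x + w x ^ 2 = -κ ^ 2) :
    κ ^ 2 * (∫ x in (0 : ℝ)..ℓ, f x * f x) + w ℓ * f ℓ ^ 2 - w 0 * f 0 ^ 2 ≤
      ∫ x in (0 : ℝ)..ℓ, f' x * f' x := by
  have cw : ContinuousOn w (Set.Icc 0 ℓ) := fun x hx => (hw x hx).continuousAt.continuousWithinAt
  have cw' : ContinuousOn w' (Set.Icc 0 ℓ) := by
    have : ContinuousOn (fun x => -κ ^ 2 - w x ^ 2) (Set.Icc 0 ℓ) :=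
      continuousOn_const.sub (cw.pow 2)
    exact this.congr fun x hx => by linarith [hric x hx]
  have pw : IsPrimitiveOn w w' ℓ := of_hasDerivAt hℓ hw cw'
  have pm := pw.mul hℓ (hf.mul hℓ hf)
  have key := pw.integral_mul_add hℓ (hf.mul hℓ hf)
  have cf := hf.continuousOn hℓ
  have iff' : IntervalIntegrable (fun x => f x * f x) volume 0 ℓ :=
    (cf.mul cf).intervalIntegrable_of_Icc hℓ
  have i2 : IntervalIntegrable (fun x => f' x * f' x) volume 0 ℓ := by
    simpa only [sq] using hL2
  have hpos : 0 ≤ ∫ x in (0 : ℝ)..ℓ, (f' x - w x * f x) ^ 2 :=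
    intervalIntegral.integral_nonneg hℓ fun x _ => sq_nonneg _
  -- Completing the square: `(f' - w f)² = f'² - (w f²)' + (w' + w²) f²`, and the Riccati equation
  -- turns the last term into `-κ² f²`.
  have heq : ∫ x in (0 : ℝ)..ℓ, (f' x - w x * f x) ^ 2 =
      ∫ x in (0 : ℝ)..ℓ, (f' x * f' x - (w' x * (f x * f x) + w x * (f' x * f x + f x * f' x))
        - κ ^ 2 * (f x * f x)) := by
    apply intervalIntegral.integral_congr
    intro x hx
    rw [Set.uIcc_of_le hℓ] at hx
    have := hric x hx
    dsimp only
    linear_combination (f x) ^ 2 * this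
  rw [heq, intervalIntegral.integral_sub (i2.sub pm.1) (iff'.const_mul _),
    intervalIntegral.integral_sub i2 pm.1, key, intervalIntegral.integral_const_mul] at hpos
  nlinarith [hpos]

/-- The sharp inequality on an edge with a Neumann end. -/
theorem tan_le (hℓ : 0 ≤ ℓ) (hf : IsPrimitiveOn f f' ℓ)
    (hL2 : IntervalIntegrable (fun x => f' x ^ 2) volume 0 ℓ) {κ : ℝ} (hκ : 0 < κ)
    (hκℓ : κ * ℓ < Real.pi / 2) :
    κ ^ 2 * (∫ x in (0 : ℝ)..ℓ, f x * f x) - κ * Real.tan (κ * ℓ) * f 0 ^ 2 ≤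
      ∫ x in (0 : ℝ)..ℓ, f' x * f' x := by
  have hcos : ∀ x ∈ Set.Icc 0 ℓ, Real.cos (κ * (ℓ - x)) ≠ 0 := by
    intro x hx
    apply (Real.cos_pos_of_mem_Ioo ⟨_, _⟩).ne'
    · nlinarith [Real.pi_pos, mul_nonneg hκ.le (sub_nonneg.2 hx.2)]
    · nlinarith [mul_nonneg hκ.le hx.1]
  -- This `w` is the logarithmic derivative of `cos (κ (ℓ - x))`; it vanishes at `ℓ`, so the free
  -- end contributes nothing.
  have h := hf.riccati_le hℓ hL2 (κ := κ) (w := fun x => κ * Real.tan (κ * (ℓ - x)))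
    (w' := fun x => κ * (1 / Real.cos (κ * (ℓ - x)) ^ 2 * (κ * (-1)))) ?_ ?_
  · simpa using h
  · intro x hx
    have h1 : HasDerivAt (fun x => κ * (ℓ - x)) (κ * (-1)) x :=
      ((hasDerivAt_id x).const_sub ℓ).const_mul κ
    exact ((Real.hasDerivAt_tan (hcos x hx)).comp x h1).const_mul κ
  · intro x hx
    have hc := hcos x hx
    rw [Real.tan_eq_sin_div_cos]
    field_simp
    linear_combination Real.sin_sq_add_cos_sq (κ * (ℓ - x))

/-- The sharp inequality on an edge with a Dirichlet end. -/
theorem cot_le (hℓ : 0 < ℓ) (hf : IsPrimitiveOn f f' ℓ)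
    (hL2 : IntervalIntegrable (fun x => f' x ^ 2) volume 0 ℓ) {κ : ℝ} (hκ : 0 < κ)
    (hκℓ : κ * ℓ < Real.pi) (h0 : f 0 = 0) :
    κ ^ 2 * (∫ x in (0 : ℝ)..ℓ, f x * f x)
      + κ * (Real.cos (κ * ℓ) / Real.sin (κ * ℓ)) * f ℓ ^ 2 ≤
      ∫ x in (0 : ℝ)..ℓ, f' x * f' x := by
  -- The logarithmic derivative of `sin (κ x)` has a pole at the Dirichlet end. A phase shift `ε >
  -- 0` removes it, the term at `0` vanishes since `f 0 = 0`, and then `ε → 0`.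
  have hev : ∀ᶠ ε : ℝ in nhdsWithin 0 (Set.Ioi 0),
      κ ^ 2 * (∫ x in (0 : ℝ)..ℓ, f x * f x)
        + κ * (Real.cos (κ * ℓ + ε) / Real.sin (κ * ℓ + ε)) * f ℓ ^ 2 ≤
        ∫ x in (0 : ℝ)..ℓ, f' x * f' x := by
    filter_upwards [Ioo_mem_nhdsGT (show (0 : ℝ) < Real.pi - κ * ℓ by linarith)] with ε hε
    have hsin : ∀ x ∈ Set.Icc 0 ℓ, Real.sin (κ * x + ε) ≠ 0 := by
      intro x hx
      apply (Real.sin_pos_of_pos_of_lt_pi _ _).ne'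
      · nlinarith [mul_nonneg hκ.le hx.1, hε.1]
      · nlinarith [mul_nonneg hκ.le (sub_nonneg.2 hx.2), hε.2]
    have h := hf.riccati_le hℓ.le hL2 (κ := κ)
      (w := fun x => κ * (Real.cos (κ * x + ε) / Real.sin (κ * x + ε)))
      (w' := fun x => κ * ((-Real.sin (κ * x + ε) * (κ * 1) * Real.sin (κ * x + ε)
        - Real.cos (κ * x + ε) * (Real.cos (κ * x + ε) * (κ * 1))) / Real.sin (κ * x + ε) ^ 2))
      ?_ ?_
    · simpa [h0] using h
    · intro x hx
      have h1 : HasDerivAt (fun x => κ * x + ε) (κ * 1) x :=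
        ((hasDerivAt_id x).const_mul κ).add_const ε
      exact ((h1.cos).div h1.sin (hsin x hx)).const_mul κ
    · intro x hx
      have hc := hsin x hx
      field_simp
      ring
  have hs : Real.sin (κ * ℓ) ≠ 0 := (Real.sin_pos_of_pos_of_lt_pi (by positivity) hκℓ).ne'
  have hlim : ContinuousAt (fun ε : ℝ => κ ^ 2 * (∫ x in (0 : ℝ)..ℓ, f x * f x)
        + κ * (Real.cos (κ * ℓ + ε) / Real.sin (κ * ℓ + ε)) * f ℓ ^ 2) 0 := by
    have : ContinuousAt (fun ε : ℝ => Real.cos (κ * ℓ + ε) / Real.sin (κ * ℓ + ε)) 0 := by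
      apply ContinuousAt.div
      · fun_prop
      · fun_prop
      · simpa using hs
    exact continuousAt_const.add ((continuousAt_const.mul this).mul continuousAt_const)
  have := le_of_tendsto (hlim.tendsto.mono_left nhdsWithin_le_nhds) hev
  simpa using this

end IsPrimitiveOn

/-! ### The first eigenvalue of a star through its secular equation. -/

/-- The secular function of the star, whose smallest positive zero is the square root of the
first eigenvalue. -/
noncomputable def starSecular (L D : ℝ) (n : ℕ) (k : ℝ) : ℝ :=
  Real.cos (k * D) -
    (n - 1) * (Real.sin (k * ((n * D - L) / (n - 1))) * Real.sin (k * ((L - D) / (n - 1))))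

namespace MetricGraph.IsH10

variable {V E : Type} {G : MetricGraph V E} {VD : Set V} {f f' : E → ℝ → ℝ}

theorem intervalIntegrable_sq (h : G.IsH10 VD f f') (e : E) :
    IntervalIntegrable (fun x => f' e x ^ 2) volume 0 (G.len e) := by
  have := (h.1 e).integrable_sq
  rw [intervalIntegrable_iff_integrableOn_Icc_of_le (NNReal.coe_nonneg (G.len e))]
  exact this

theorem isPrimitiveOn (h : G.IsH10 VD f f') (e : E) :
    IsPrimitiveOn (f e) (f' e) (G.len e) := by
  refine ⟨?_, h.2.1 e⟩
  rw [intervalIntegrable_iff_integrableOn_Icc_of_le (NNReal.coe_nonneg (G.len e))]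
  exact (h.1 e).integrable (by norm_num)

end MetricGraph.IsH10

section Star

variable {L D : ℝ} {n : ℕ}

theorem starGraph_len_none (hn : 2 ≤ n) (hnD : L < n * D) :
    (((starGraph L D n).len none : NNReal) : ℝ) = (n * D - L) / (n - 1) := by
  have : (2 : ℝ) ≤ n := by exact_mod_cast hn
  exact Real.coe_toNNReal _ (div_nonneg (by linarith) (by linarith))

theorem starGraph_len_some (hn : 2 ≤ n) (hDL : D ≤ L) (i : Fin n) :
    (((starGraph L D n).len (some i) : NNReal) : ℝ) = (L - D) / (n - 1) := by
  have : (2 : ℝ) ≤ n := by exact_mod_cast hn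
  exact Real.coe_toNNReal _ (div_nonneg (by linarith) (by linarith))

/-- This is the Kirchhoff form of the secular function, `cot (k a) = n tan (k b)` with denominators
cleared; the defining form serves for monotonicity and limits. -/
theorem starSecular_eq (hn : 2 ≤ n) (k : ℝ) :
    starSecular L D n k =
      Real.cos (k * ((n * D - L) / (n - 1))) * Real.cos (k * ((L - D) / (n - 1))) -
      n * (Real.sin (k * ((n * D - L) / (n - 1))) * Real.sin (k * ((L - D) / (n - 1)))) := by
  have h2 : (2 : ℝ) ≤ n := by exact_mod_cast hn
  have h1 : (n : ℝ) - 1 ≠ 0 := by linarith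
  have : k * D = k * ((n * D - L) / (n - 1)) + k * ((L - D) / (n - 1)) := by
    field_simp; ring
  rw [starSecular, this, Real.cos_add]
  ring

/-- The eigenvalues of the star are bounded below by the square of a small zero of the secular
function. -/
theorem sq_le_of_mem_starEigenvalues (hDL : D ≤ L) (hn : 2 ≤ n) (hnD : L < n * D) {k : ℝ}
    (hk : 0 < k) (hkD : k * D ≤ Real.pi / 2) (hroot : starSecular L D n k = 0) {μ : ℝ}
    (hμ : μ ∈ starEigenvalues L D n) : k ^ 2 ≤ μ := by
  obtain ⟨f, f', hf, hpos, heq⟩ := hμ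
  have h2 : (2 : ℝ) ≤ n := by exact_mod_cast hn
  have hE := heq f f' hf
  have l0 := starGraph_len_none hn hnD
  have l1 := starGraph_len_some (n := n) hn hDL
  have p0 := hf.isPrimitiveOn none
  have s0 := hf.intervalIntegrable_sq none
  have p1 := fun i => hf.isPrimitiveOn (some i)
  have s1 := fun i => hf.intervalIntegrable_sq (some i)
  rw [starSecular_eq hn] at hroot
  obtain ⟨φ, hφ, hφ0⟩ := hf.2.2
  simp only [MetricGraph.inner, Fintype.sum_option, l0, l1] at hE hpos p0 p1 s0 s1 hφ
  have hb : (n * D - L) / (n - 1) + (L - D) / (n - 1) = D := by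
    have h1 : (n : ℝ) - 1 ≠ 0 := by linarith
    field_simp; ring
  have ha0 : 0 < (n * D - L) / ((n : ℝ) - 1) := div_pos (by linarith) (by linarith)
  have ha1 : 0 ≤ (L - D) / ((n : ℝ) - 1) := div_nonneg (by linarith) (by linarith)
  have hv0 : f none 0 = 0 := by rw [(hφ none).1]; exact hφ0 _ rfl
  have hc0 : f none (((starGraph L D n).len none : NNReal) : ℝ) = φ .center := (hφ none).2
  have hc1 : ∀ i, f (some i) 0 = φ .center := fun i => (hφ (some i)).1
  rw [l0] at hc0
  generalize (n * D - L) / ((n : ℝ) - 1) = a at *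
  generalize (L - D) / ((n : ℝ) - 1) = b at *
  have hka : k * a ≤ Real.pi / 2 := by nlinarith
  have hkb : k * b < Real.pi / 2 := by nlinarith
  have e0 := p0.cot_le ha0 s0 hk (by linarith [Real.pi_pos]) hv0
  have e1 := fun i => (p1 i).tan_le ha1 (s1 i) hk hkb
  simp only [hc1] at e1
  rw [hc0] at e0
  have hsum := Finset.sum_le_sum fun i (_ : i ∈ Finset.univ) => e1 i
  rw [Finset.sum_sub_distrib, ← Finset.mul_sum, Finset.sum_const, Finset.card_univ,
    Fintype.card_fin, nsmul_eq_mul] at hsum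
  have hsa : 0 < Real.sin (k * a) :=
    Real.sin_pos_of_pos_of_lt_pi (by positivity) (by linarith [Real.pi_pos])
  have hcb : 0 < Real.cos (k * b) := Real.cos_pos_of_mem_Ioo
    ⟨by nlinarith [Real.pi_pos, mul_nonneg hk.le ha1], hkb⟩
  -- At a zero of the secular function, the term at the centre from the Dirichlet edge cancels those
  -- from the `n` other edges.
  have hkir : Real.cos (k * a) / Real.sin (k * a) = n * Real.tan (k * b) := by
    rw [Real.tan_eq_sin_div_cos]
    field_simp
    linarith
  rw [hkir] at e0
  -- The edge inequalities add up to `k² ∫ f² ≤ ∫ f'² = μ ∫ f²`, and `∫ f² > 0`.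
  by_contra! hlt
  nlinarith [mul_pos (sub_pos.2 hlt) hpos]

theorem sq_mem_starEigenvalues (hDL : D ≤ L) (hn : 2 ≤ n) (hnD : L < n * D) {k : ℝ}
    (hk : 0 < k) (hkD : k * D ≤ Real.pi / 2) (hroot : starSecular L D n k = 0) :
    k ^ 2 ∈ starEigenvalues L D n := by
  have h2 : (2 : ℝ) ≤ n := by exact_mod_cast hn
  have l0 := starGraph_len_none hn hnD
  have l1 := starGraph_len_some (n := n) hn hDL
  rw [starSecular_eq hn] at hroot
  have hb : (n * D - L) / (n - 1) + (L - D) / (n - 1) = D := by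
    have h1 : (n : ℝ) - 1 ≠ 0 := by linarith
    field_simp; ring
  have ha0 : 0 < (n * D - L) / ((n : ℝ) - 1) := div_pos (by linarith) (by linarith)
  have ha1 : 0 ≤ (L - D) / ((n : ℝ) - 1) := div_nonneg (by linarith) (by linarith)
  generalize (n * D - L) / ((n : ℝ) - 1) = a at *
  generalize (L - D) / ((n : ℝ) - 1) = b at *
  have hka : k * a ≤ Real.pi / 2 := by nlinarith
  have hkb : k * b < Real.pi / 2 := by nlinarith
  have hcb : 0 < Real.cos (k * b) := Real.cos_pos_of_mem_Ioo
    ⟨by nlinarith [Real.pi_pos, mul_nonneg hk.le ha1], hkb⟩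
  -- The factors `cos (k b)` and `sin (k a)` make the values at the centre agree.
  let f : Option (Fin n) → ℝ → ℝ := fun e x => match e with
    | none => Real.sin (k * x) * Real.cos (k * b)
    | some _ => Real.sin (k * a) * Real.cos (k * (b - x))
  let f' : Option (Fin n) → ℝ → ℝ := fun e x => match e with
    | none => k * Real.cos (k * x) * Real.cos (k * b)
    | some _ => k * (Real.sin (k * a) * Real.sin (k * (b - x)))
  have hder : ∀ e x, HasDerivAt (f e) (f' e x) x := by
    rintro (_ | i) x
    · have h1 : HasDerivAt (fun x => k * x) (k * 1) x := (hasDerivAt_id x).const_mul k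
      exact (h1.sin.mul_const _).congr_deriv (by simp only [f']; ring)
    · have h1 : HasDerivAt (fun x => k * (b - x)) (k * (-1)) x :=
        ((hasDerivAt_id x).const_sub b).const_mul k
      exact (h1.cos.const_mul _).congr_deriv (by simp only [f']; ring)
  have hder' : ∀ e x, HasDerivAt (f' e) (-k ^ 2 * f e x) x := by
    rintro (_ | i) x
    · have h1 : HasDerivAt (fun x => k * x) (k * 1) x := (hasDerivAt_id x).const_mul k
      exact ((h1.cos.const_mul k).mul_const _).congr_deriv (by simp only [f]; ring)
    · have h1 : HasDerivAt (fun x => k * (b - x)) (k * (-1)) x :=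
        ((hasDerivAt_id x).const_sub b).const_mul k
      exact ((h1.sin.const_mul _).const_mul k).congr_deriv (by simp only [f]; ring)
  have cf : ∀ e, Continuous (f e) := fun e =>
    continuous_iff_continuousAt.2 fun x => (hder e x).continuousAt
  have cf' : ∀ e, Continuous (f' e) := fun e =>
    continuous_iff_continuousAt.2 fun x => (hder' e x).continuousAt
  refine ⟨f, f', ⟨fun e => ?_, fun e => ?_, ?_⟩, ?_, ?_⟩
  · obtain ⟨C, hC⟩ := isCompact_Icc.exists_bound_of_continuousOn
      (cf' e).continuousOn (s := Set.Icc (0 : ℝ) ((starGraph L D n).len e))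
    exact MemLp.of_bound (cf' e).aestronglyMeasurable C
      ((ae_restrict_iff' measurableSet_Icc).2 (Filter.Eventually.of_forall hC))
  · exact (IsPrimitiveOn.of_hasDerivAt (NNReal.coe_nonneg _) (fun x _ => hder e x)
      (cf' e).continuousOn).2
  · refine ⟨fun v => match v with
      | .v₀ => 0
      | .center => Real.sin (k * a) * Real.cos (k * b)
      | .leaf _ => Real.sin (k * a), ?_, ?_⟩
    · rintro (_ | i)
      · rw [l0]; simp [f, starGraph]
      · rw [l1]; simp [f, starGraph]
    · rintro v rfl
      rfl
  · simp only [MetricGraph.inner, Fintype.sum_option, l0, l1]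
    apply add_pos_of_pos_of_nonneg
    · apply intervalIntegral.intervalIntegral_pos_of_pos_on
      · exact ((cf none).mul (cf none)).intervalIntegrable _ _
      · intro x hx
        have : 0 < Real.sin (k * x) := Real.sin_pos_of_pos_of_lt_pi (mul_pos hk hx.1)
          (by nlinarith [hx.2, Real.pi_pos])
        exact mul_self_pos.2 (mul_pos this hcb).ne'
      · exact ha0
    · exact Finset.sum_nonneg fun i _ =>
        intervalIntegral.integral_nonneg ha1 fun x _ => mul_self_nonneg _
  · intro g g' hg
    have key : ∀ e, ∫ x in (0 : ℝ)..((starGraph L D n).len e : ℝ), f' e x * g' e x =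
        f' e ((starGraph L D n).len e) * g e ((starGraph L D n).len e) - f' e 0 * g e 0
          + k ^ 2 * ∫ x in (0 : ℝ)..((starGraph L D n).len e : ℝ), f e x * g e x := by
      intro e
      have hℓ : (0 : ℝ) ≤ (starGraph L D n).len e := NNReal.coe_nonneg _
      have pg := hg.isPrimitiveOn e
      have cg := pg.continuousOn hℓ
      have pf := IsPrimitiveOn.of_hasDerivAt hℓ (fun x _ => hder' e x)
        ((cf e).const_mul (-k ^ 2)).continuousOn
      have h := pf.integral_mul_add hℓ pg
      rw [intervalIntegral.integral_add] at h
      · simp only [mul_assoc, intervalIntegral.integral_const_mul] at h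
        linarith
      · exact (((cf e).const_mul _).continuousOn.mul cg).intervalIntegrable_of_Icc hℓ
      · exact pg.1.continuousOn_mul (cf' e).continuousOn
    obtain ⟨φ, hφ, hφ0⟩ := hg.2.2
    have hv0 : g none 0 = 0 := by rw [(hφ none).1]; exact hφ0 _ rfl
    have hc0 : g none ((starGraph L D n).len none) = φ .center := (hφ none).2
    have hc1 : ∀ i, g (some i) 0 = φ .center := fun i => (hφ (some i)).1
    simp only [MetricGraph.inner, key, Fintype.sum_option, hv0, hc0, hc1]
    simp only [l0, l1, f', Finset.sum_add_distrib, ← Finset.mul_sum, sub_self, mul_zero,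
      Real.sin_zero, zero_mul, zero_sub, sub_zero, Finset.sum_const, Finset.card_univ,
      Fintype.card_fin, nsmul_eq_mul]
    -- Boundary terms survive only at the centre: `g` vanishes at `v₀` and `f'` at the leaves. Their
    -- sum is `k φ(center)` times the secular function.
    linear_combination k * φ .center * hroot

end Star

/-! ### The limit equation and the monotonicity of its root. -/

/-- The secular function of the limit problem. -/
noncomputable def limitSecular (L D w : ℝ) : ℝ :=
  Real.cos (w * D) - w * ((L - D) * Real.sin (w * D))

theorem exists_root_of_nonpos {F : ℝ → ℝ} {b : ℝ} (hb : 0 < b) (hc : Continuous F) (h0 : 0 < F 0)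
    (h1 : F b ≤ 0) : ∃ k, 0 < k ∧ k ≤ b ∧ F k = 0 := by
  obtain ⟨k, hk, hk0⟩ := intermediate_value_Icc' hb.le hc.continuousOn ⟨h1, h0.le⟩
  refine ⟨k, lt_of_le_of_ne hk.1 ?_, hk.2, hk0⟩
  rintro rfl
  exact h0.ne' hk0

theorem monotoneOn_sin_mul {c b : ℝ} (hc : 0 ≤ c) (hb : b * c ≤ Real.pi / 2) :
    MonotoneOn (fun k => Real.sin (k * c)) (Set.Icc 0 b) := by
  intro x hx y hy hxy
  have hx0 := mul_nonneg hx.1 hc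
  have hyb := mul_le_mul_of_nonneg_right hy.2 hc
  exact Real.sin_le_sin_of_le_of_le_pi_div_two (by linarith [Real.pi_pos]) (by linarith)
    (mul_le_mul_of_nonneg_right hxy hc)

theorem sin_mul_nonneg {c b k : ℝ} (hc : 0 ≤ c) (hb : b * c ≤ Real.pi / 2)
    (hk : k ∈ Set.Icc 0 b) : 0 ≤ Real.sin (k * c) := by
  have := mul_le_mul_of_nonneg_right hk.2 hc
  exact Real.sin_nonneg_of_nonneg_of_le_pi (mul_nonneg hk.1 hc) (by linarith [Real.pi_pos])

theorem strictAntiOn_cos_mul {D : ℝ} (hD : 0 < D) :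
    StrictAntiOn (fun k => Real.cos (k * D)) (Set.Icc 0 (Real.pi / 2 / D)) := by
  intro x hx y hy hxy
  have hy' := (le_div_iff₀ hD).1 hy.2
  exact Real.cos_lt_cos_of_nonneg_of_le_pi_div_two (mul_nonneg hx.1 hD.le) hy'
    (mul_lt_mul_of_pos_right hxy hD)

section Secular

variable {L D : ℝ}

theorem continuous_limitSecular : Continuous (limitSecular L D) := by
  unfold limitSecular; fun_prop

theorem strictAntiOn_limitSecular (hD : 0 < D) (hDL : D ≤ L) :
    StrictAntiOn (limitSecular L D) (Set.Icc 0 (Real.pi / 2 / D)) := by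
  intro x hx y hy hxy
  have h1 : Real.cos (y * D) < Real.cos (x * D) := strictAntiOn_cos_mul hD hx hy hxy
  have hb : Real.pi / 2 / D * D ≤ Real.pi / 2 := by rw [div_mul_cancel₀ _ hD.ne']
  have h2 : Real.sin (x * D) ≤ Real.sin (y * D) := monotoneOn_sin_mul hD.le hb hx hy hxy.le
  have h3 := sin_mul_nonneg hD.le hb hx
  have h4 : (L - D) * Real.sin (x * D) ≤ (L - D) * Real.sin (y * D) :=
    mul_le_mul_of_nonneg_left h2 (by linarith)
  have h5 := mul_le_mul hxy.le h4 (mul_nonneg (by linarith) h3) hy.1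
  unfold limitSecular
  linarith

theorem limitSecular_zero : limitSecular L D 0 = 1 := by simp [limitSecular]

theorem limitSecular_pi_div (hD : 0 < D) :
    limitSecular L D (Real.pi / 2 / D) = -(Real.pi / 2 / D * (L - D)) := by
  rw [limitSecular, div_mul_cancel₀ _ hD.ne']
  simp

/-- The limit root is the least positive zero of the limit secular function, and lies in the
interval `(0, π / (2 D)]`. -/
theorem limitRoot_spec (hD : 0 < D) (hDL : D ≤ L) :
    IsLeast (limitRoots L D) (limitRoot L D) ∧ limitRoot L D ≤ Real.pi / 2 / D ∧
      limitSecular L D (limitRoot L D) = 0 := by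
  have hb : 0 < Real.pi / 2 / D := by positivity
  obtain ⟨w, hw, hwb, hw0⟩ := exists_root_of_nonpos hb (continuous_limitSecular (L := L) (D := D))
    (by rw [limitSecular_zero]; norm_num)
    (by rw [limitSecular_pi_div hD, neg_nonpos]; exact mul_nonneg hb.le (by linarith))
  have hl : IsLeast (limitRoots L D) w := by
    refine ⟨⟨hw, by unfold limitSecular at hw0; linarith⟩, fun v hv => ?_⟩
    by_contra! hlt
    have := strictAntiOn_limitSecular hD hDL ⟨hv.1.le, hlt.le.trans hwb⟩ ⟨hw.le, hwb⟩ hlt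
    have hv2 := hv.2
    rw [hw0, limitSecular] at this
    linarith
  have : limitRoot L D = w := hl.csInf_eq
  rw [this]
  exact ⟨hl, hwb, hw0⟩

theorem limitRoot_pos (hD : 0 < D) (hDL : D ≤ L) : 0 < limitRoot L D :=
  (limitRoot_spec hD hDL).1.1.1

/-- Turns comparisons with the root into sign questions, by strict monotonicity. -/
theorem limitRoot_lt_iff (hD : 0 < D) (hDL : D ≤ L) {w : ℝ}
    (hw : w ∈ Set.Icc 0 (Real.pi / 2 / D)) :
    limitRoot L D < w ↔ limitSecular L D w < 0 := by
  have h := limitRoot_spec hD hDL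
  rw [← h.2.2]
  exact ((strictAntiOn_limitSecular hD hDL).lt_iff_gt hw ⟨(limitRoot_pos hD hDL).le, h.2.1⟩).symm

/-- In the derivative with respect to `D` the sine terms cancel, leaving `-w² (L - D) cos (w D)`. -/
theorem limitSecular_strictAnti_right {w D₁ D₂ : ℝ} (hw : 0 < w) (h0 : 0 ≤ D₁) (h12 : D₁ < D₂)
    (h2 : D₂ ≤ L) (hw2 : w * D₂ ≤ Real.pi / 2) : limitSecular L D₂ w < limitSecular L D₁ w := by
  have hd : ∀ x, HasDerivAt (fun x => limitSecular L x w)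
      (-(w ^ 2 * ((L - x) * Real.cos (w * x)))) x := by
    intro x
    have h1 : HasDerivAt (fun x => w * x) (w * 1) x := (hasDerivAt_id x).const_mul w
    have h2 := ((hasDerivAt_id x).const_sub L).mul h1.sin
    exact (h1.cos.sub (h2.const_mul w)).congr_deriv (by simp only [id]; ring)
  refine strictAntiOn_of_deriv_neg (convex_Icc 0 D₂)
    (fun x _ => (hd x).continuousAt.continuousWithinAt) (fun x hx => ?_)
    ⟨h0, h12.le⟩ ⟨h0.trans h12.le, le_rfl⟩ h12
  rw [interior_Icc] at hx
  rw [(hd x).deriv, neg_lt_zero]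
  have hwx := mul_lt_mul_of_pos_left hx.2 hw
  have := mul_pos hw hx.1
  have hc : 0 < Real.cos (w * x) := Real.cos_pos_of_mem_Ioo
    ⟨by linarith [Real.pi_pos], by linarith⟩
  have : 0 < L - x := by linarith [hx.2]
  positivity

theorem limitRoot_strictAntiOn : StrictAntiOn (limitRoot L) (Set.Ioc 0 L) := by
  intro D₁ h1 D₂ h2 h12
  have s1 := limitRoot_spec h1.1 h1.2
  have s2 := limitRoot_spec h2.1 h2.2
  have p1 := limitRoot_pos h1.1 h1.2
  -- The sign criterion for `D₂` applies only up to `π / (2 D₂)`; beyond that point the root for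
  -- `D₂` is smaller anyway.
  rcases le_or_gt (limitRoot L D₁) (Real.pi / 2 / D₂) with h | h
  · rw [limitRoot_lt_iff h2.1 h2.2 ⟨p1.le, h⟩, ← s1.2.2]
    exact limitSecular_strictAnti_right p1 h1.1.le h12 h2.2 ((le_div_iff₀ h2.1).1 h)
  · exact s2.2.1.trans_lt h

/-! ### Bounds on `t cot t` and on the limit root. -/

/-- The difference of the two sides vanishes at `0` and has derivative `(x² / 2) cos x ≥ 0`. -/
theorem one_sub_sq_div_two_mul_sin_le {t : ℝ} (h0 : 0 ≤ t) (ht : t ≤ Real.pi / 2) :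
    (1 - t ^ 2 / 2) * Real.sin t ≤ t * Real.cos t := by
  have hd : ∀ x, HasDerivAt (fun x => x * Real.cos x - (1 - x ^ 2 / 2) * Real.sin x)
      (x ^ 2 / 2 * Real.cos x) x := by
    intro x
    have h1 := (hasDerivAt_id x).mul (Real.hasDerivAt_cos x)
    have h2 := ((((hasDerivAt_id x).pow 2).div_const 2).const_sub 1).mul (Real.hasDerivAt_sin x)
    exact (h1.sub h2).congr_deriv (by simp; ring)
  have := monotoneOn_of_deriv_nonneg (convex_Icc 0 t)
    (fun x _ => (hd x).continuousAt.continuousWithinAt)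
    (fun x _ => (hd x).differentiableAt.differentiableWithinAt) (fun x hx => ?_)
    ⟨le_rfl, h0⟩ ⟨h0, le_rfl⟩ h0
  · simp at this
    linarith
  · rw [interior_Icc] at hx
    rw [(hd x).deriv]
    have := Real.cos_nonneg_of_neg_pi_div_two_le_of_le (x := x)
      (by linarith [hx.1, Real.pi_pos]) (by linarith [hx.2])
    positivity

theorem mul_cos_le_sin {t : ℝ} (h0 : 0 ≤ t) (ht : t ≤ Real.pi / 2) :
    t * Real.cos t ≤ Real.sin t := by
  rcases ht.lt_or_eq with ht | rfl
  · have hc : 0 < Real.cos t := Real.cos_pos_of_mem_Ioo ⟨by linarith [Real.pi_pos], ht⟩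
    have := Real.le_tan h0 ht
    rwa [Real.tan_eq_sin_div_cos, le_div_iff₀ hc] at this
  · simp

/-- The difference of the two sides vanishes at `0` and has derivative `(x / 3) (sin x - x cos x) ≥
0`. -/
theorem mul_cos_le_one_sub_sq_div_three_mul_sin {t : ℝ} (h0 : 0 ≤ t) (ht : t ≤ Real.pi / 2) :
    t * Real.cos t ≤ (1 - t ^ 2 / 3) * Real.sin t := by
  have hd : ∀ x, HasDerivAt (fun x => (1 - x ^ 2 / 3) * Real.sin x - x * Real.cos x)
      (x / 3 * (Real.sin x - x * Real.cos x)) x := by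
    intro x
    have h1 := (hasDerivAt_id x).mul (Real.hasDerivAt_cos x)
    have h2 := ((((hasDerivAt_id x).pow 2).div_const 3).const_sub 1).mul (Real.hasDerivAt_sin x)
    exact (h2.sub h1).congr_deriv (by simp; ring)
  have := monotoneOn_of_deriv_nonneg (convex_Icc 0 t)
    (fun x _ => (hd x).continuousAt.continuousWithinAt)
    (fun x _ => (hd x).differentiableAt.differentiableWithinAt) (fun x hx => ?_)
    ⟨le_rfl, h0⟩ ⟨h0, le_rfl⟩ h0
  · simp at this
    linarith
  · rw [interior_Icc] at hx
    rw [(hd x).deriv]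
    have := mul_cos_le_sin hx.1.le (hx.2.le.trans ht)
    exact mul_nonneg (by linarith [hx.1]) (by linarith)

/-- With `t = w D` the limit equation reads `t cot t = w² D (L - D)`, so bounds on `t cot t` by `1 -
c t²` become linear inequalities in `w²`. -/
theorem limitRoot_sq_bounds (hD : 0 < D) (hDL : D ≤ L) :
    1 ≤ limitRoot L D ^ 2 * (L * D - D ^ 2 / 2) ∧
      limitRoot L D ^ 2 * (3 * L * D - 2 * D ^ 2) ≤ 3 := by
  obtain ⟨-, hb, h0⟩ := limitRoot_spec hD hDL
  have hp := limitRoot_pos hD hDL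
  generalize limitRoot L D = w at *
  rw [le_div_iff₀ hD] at hb
  have hs : 0 < D * Real.sin (w * D) :=
    mul_pos hD (Real.sin_pos_of_pos_of_lt_pi (by positivity) (by linarith [Real.pi_pos]))
  have hA := one_sub_sq_div_two_mul_sin_le (t := w * D) (by positivity) hb
  have hB := mul_cos_le_one_sub_sq_div_three_mul_sin (t := w * D) (by positivity) hb
  have hcos : w * D * Real.cos (w * D) = w ^ 2 * (L - D) * (D * Real.sin (w * D)) := by
    unfold limitSecular at h0
    linear_combination w * D * h0
  rw [hcos] at hA hB
  have hA' := mul_le_mul_of_nonneg_left hA hD.le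
  have hB' := mul_le_mul_of_nonneg_left hB hD.le
  constructor
  · refine le_of_mul_le_mul_right ?_ hs
    linarith
  · refine le_of_mul_le_mul_right ?_ hs
    linarith

end Secular

/-! ### Comparison of the star secular functions with each other and with their limit. -/

section Star

variable {L D : ℝ} {n m : ℕ}

theorem continuous_starSecular : Continuous (starSecular L D n) := by
  unfold starSecular; fun_prop

theorem strictAntiOn_starSecular (hD : 0 < D) (hDL : D ≤ L) (hn : 2 ≤ n) (hnD : L < n * D) :
    StrictAntiOn (starSecular L D n) (Set.Icc 0 (Real.pi / 2 / D)) := by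
  intro x hx y hy hxy
  have h2 : (2 : ℝ) ≤ n := by exact_mod_cast hn
  have h1 : Real.cos (y * D) < Real.cos (x * D) := strictAntiOn_cos_mul hD hx hy hxy
  have hb0 : 0 ≤ Real.pi / 2 / D := by positivity
  have hb : Real.pi / 2 / D * D ≤ Real.pi / 2 := by rw [div_mul_cancel₀ _ hD.ne']
  have hsum : (n * D - L) / (n - 1) + (L - D) / (n - 1) = D := by
    have h1 : (n : ℝ) - 1 ≠ 0 := by linarith
    field_simp; ring
  have ha0 : 0 ≤ (n * D - L) / ((n : ℝ) - 1) := div_nonneg (by linarith) (by linarith)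
  have ha1 : 0 ≤ (L - D) / ((n : ℝ) - 1) := div_nonneg (by linarith) (by linarith)
  unfold starSecular
  generalize (n * D - L) / ((n : ℝ) - 1) = a at *
  generalize (L - D) / ((n : ℝ) - 1) = b at *
  have hka : Real.pi / 2 / D * a ≤ Real.pi / 2 :=
    (mul_le_mul_of_nonneg_left (by linarith) hb0).trans hb
  have hkb : Real.pi / 2 / D * b ≤ Real.pi / 2 :=
    (mul_le_mul_of_nonneg_left (by linarith) hb0).trans hb
  have := mul_le_mul (monotoneOn_sin_mul ha0 hka hx hy hxy.le)
    (monotoneOn_sin_mul ha1 hkb hx hy hxy.le) (sin_mul_nonneg ha1 hkb hx)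
    (sin_mul_nonneg ha0 hka hy)
  have := mul_le_mul_of_nonneg_left this (show (0 : ℝ) ≤ n - 1 by linarith)
  linarith

/-- The first eigenvalue of the star is the square of the only zero of the secular function in
`(0, π / (2 D)]`. -/
theorem starFirstEigenvalue_spec (hD : 0 < D) (hDL : D ≤ L) (hn : 2 ≤ n) (hnD : L < n * D) :
    ∃ k, 0 < k ∧ k ≤ Real.pi / 2 / D ∧ starSecular L D n k = 0 ∧
      starFirstEigenvalue L D n = k ^ 2 ∧ IsLeast (starEigenvalues L D n) (k ^ 2) := by
  have h2 : (2 : ℝ) ≤ n := by exact_mod_cast hn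
  have hb : 0 < Real.pi / 2 / D := by positivity
  have hbD : Real.pi / 2 / D * D = Real.pi / 2 := div_mul_cancel₀ _ hD.ne'
  have hsum : (n * D - L) / (n - 1) + (L - D) / (n - 1) = D := by
    have h1 : (n : ℝ) - 1 ≠ 0 := by linarith
    field_simp; ring
  have ha0 : 0 ≤ (n * D - L) / ((n : ℝ) - 1) := div_nonneg (by linarith) (by linarith)
  have ha1 : 0 ≤ (L - D) / ((n : ℝ) - 1) := div_nonneg (by linarith) (by linarith)
  obtain ⟨k, hk, hkb, hk0⟩ := exists_root_of_nonpos hb (continuous_starSecular (L := L) (D := D) (n := n))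
    (by simp [starSecular]) (by
      rw [starSecular, hbD, Real.cos_pi_div_two, zero_sub, neg_nonpos]
      have hmem : Real.pi / 2 / D ∈ Set.Icc 0 (Real.pi / 2 / D) := ⟨hb.le, le_rfl⟩
      refine mul_nonneg (by linarith)
        (mul_nonneg (sin_mul_nonneg ha0 ?_ hmem) (sin_mul_nonneg ha1 ?_ hmem))
      · exact (mul_le_mul_of_nonneg_left (by linarith) hb.le).trans hbD.le
      · exact (mul_le_mul_of_nonneg_left (by linarith) hb.le).trans hbD.le)
  have hkD := (le_div_iff₀ hD).1 hkb
  have hl : IsLeast (starEigenvalues L D n) (k ^ 2) :=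
    ⟨sq_mem_starEigenvalues hDL hn hnD hk hkD hk0,
      fun μ hμ => sq_le_of_mem_starEigenvalues hDL hn hnD hk hkD hk0 hμ⟩
  exact ⟨k, hk, hkb, hk0, hl.csInf_eq, hl⟩

theorem mul_sin_lt_sin_mul {t y : ℝ} (ht0 : 0 < t) (ht1 : t < 1) (hy : 0 < y)
    (hyπ : y ≤ Real.pi) : t * Real.sin y < Real.sin (t * y) := by
  have := strictConcaveOn_sin_Icc.2 (x := y) ⟨hy.le, hyπ⟩ (y := 0) ⟨le_rfl, Real.pi_pos.le⟩
    hy.ne' ht0 (sub_pos.2 ht1) (by ring)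
  simpa using this

/-- Strict concavity of sine makes `(n - 1) sin (k (L - D) / (n - 1))` increase with `n`; the long
edge, hence its sine factor, grows as well. -/
theorem starSecular_lt (hD : 0 < D) (hDL : D < L) (hn : 2 ≤ n) (hnD : L < n * D) (hnm : n < m)
    {k : ℝ} (hk : 0 < k) (hkb : k ≤ Real.pi / 2 / D) :
    starSecular L D m k < starSecular L D n k := by
  have h2 : (2 : ℝ) ≤ n := by exact_mod_cast hn
  have hm : (n : ℝ) < m := by exact_mod_cast hnm
  have hkD := (le_div_iff₀ hD).1 hkb
  have hn1 : (0 : ℝ) < n - 1 := by linarith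
  have hm1 : (0 : ℝ) < m - 1 := by linarith
  have e1 : (n * D - L) / ((n : ℝ) - 1) = D - (L - D) / (n - 1) := by
    field_simp; ring
  have e2 : (m * D - L) / ((m : ℝ) - 1) = D - (L - D) / (m - 1) := by
    field_simp; ring
  have ha0 : 0 < (n * D - L) / ((n : ℝ) - 1) := div_pos (by linarith) hn1
  have ha1 : 0 < (L - D) / ((n : ℝ) - 1) := div_pos (by linarith) hn1
  have hb1 : 0 < (L - D) / ((m : ℝ) - 1) := div_pos (by linarith) hm1
  have hlt : (L - D) / ((m : ℝ) - 1) < (L - D) / ((n : ℝ) - 1) :=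
    div_lt_div_of_pos_left (by linarith) hn1 (by linarith)
  have heq : k * ((L - D) / ((m : ℝ) - 1)) =
      ((n - 1) / (m - 1)) * (k * ((L - D) / ((n : ℝ) - 1))) := by
    field_simp
  have hs : (n - 1) * Real.sin (k * ((L - D) / ((n : ℝ) - 1))) <
      (m - 1) * Real.sin (k * ((L - D) / ((m : ℝ) - 1))) := by
    have hkD' : k * ((L - D) / ((n : ℝ) - 1)) ≤ k * D :=
      mul_le_mul_of_nonneg_left (by linarith) hk.le
    have := mul_sin_lt_sin_mul (t := (n - 1) / ((m : ℝ) - 1))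
      (y := k * ((L - D) / ((n : ℝ) - 1))) (by positivity)
      ((div_lt_one hm1).2 (by linarith)) (by positivity) (by linarith [Real.pi_pos])
    rw [heq]
    calc _ = (m - 1) * ((n - 1) / ((m : ℝ) - 1) *
          Real.sin (k * ((L - D) / ((n : ℝ) - 1)))) := by field_simp
      _ < _ := mul_lt_mul_of_pos_left this hm1
  unfold starSecular
  rw [e1] at ha0 ⊢
  rw [e2]
  generalize (L - D) / ((n : ℝ) - 1) = a at *
  generalize (L - D) / ((m : ℝ) - 1) = b at *
  have q1 : 0 < k * (D - a) := mul_pos hk ha0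
  have q2 : k * (D - a) ≤ k * (D - b) := mul_le_mul_of_nonneg_left (by linarith) hk.le
  have q3 : k * (D - b) ≤ k * D := mul_le_mul_of_nonneg_left (by linarith) hk.le
  have q4 : k * a ≤ k * D := mul_le_mul_of_nonneg_left (by linarith) hk.le
  have r1 : 0 < Real.sin (k * (D - a)) :=
    Real.sin_pos_of_pos_of_lt_pi q1 (by linarith [Real.pi_pos])
  have r2 : Real.sin (k * (D - a)) ≤ Real.sin (k * (D - b)) :=
    Real.sin_le_sin_of_le_of_le_pi_div_two (by linarith [Real.pi_pos]) (by linarith) q2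
  have r3 : 0 ≤ Real.sin (k * a) :=
    Real.sin_nonneg_of_nonneg_of_le_pi (by positivity) (by linarith [Real.pi_pos])
  have := mul_lt_mul' r2 hs (mul_nonneg hn1.le r3) (r1.trans_le r2)
  linarith

/-- Both factors of the product grow in the limit: `sin x < x` for the short edges, and the long
edge is shorter than `D`. -/
theorem limitSecular_lt_starSecular (hD : 0 < D) (hDL : D < L) (hn : 2 ≤ n) (hnD : L < n * D)
    {k : ℝ} (hk : 0 < k) (hkb : k ≤ Real.pi / 2 / D) :
    limitSecular L D k < starSecular L D n k := by
  have h2 : (2 : ℝ) ≤ n := by exact_mod_cast hn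
  have hkD := (le_div_iff₀ hD).1 hkb
  have hn1 : (0 : ℝ) < n - 1 := by linarith
  have e1 : (n * D - L) / ((n : ℝ) - 1) = D - (L - D) / (n - 1) := by
    field_simp; ring
  have ha0 : 0 < (n * D - L) / ((n : ℝ) - 1) := div_pos (by linarith) hn1
  have ha1 : 0 < (L - D) / ((n : ℝ) - 1) := div_pos (by linarith) hn1
  have hs : (n - 1) * Real.sin (k * ((L - D) / ((n : ℝ) - 1))) < k * (L - D) := by
    calc _ < (n - 1) * (k * ((L - D) / ((n : ℝ) - 1))) :=
          mul_lt_mul_of_pos_left (Real.sin_lt (by positivity)) hn1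
      _ = _ := by field_simp
  unfold starSecular limitSecular
  rw [e1] at ha0 ⊢
  generalize (L - D) / ((n : ℝ) - 1) = a at *
  have q1 : 0 < k * (D - a) := mul_pos hk ha0
  have q3 : k * (D - a) < k * D := mul_lt_mul_of_pos_left (by linarith) hk
  have r1 : 0 < Real.sin (k * (D - a)) :=
    Real.sin_pos_of_pos_of_lt_pi q1 (by linarith [Real.pi_pos])
  have r2 : Real.sin (k * (D - a)) < Real.sin (k * D) :=
    Real.sin_lt_sin_of_lt_of_le_pi_div_two (by linarith [Real.pi_pos]) (by linarith) q3
  have h3 := mul_lt_mul_of_pos_left hs r1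
  have h4 := mul_lt_mul_of_pos_right r2 (mul_pos hk (sub_pos.2 hDL))
  linarith

theorem starSecular_self (hD : D = L) (k : ℝ) :
    starSecular L D n k = limitSecular L D k := by
  subst hD
  simp [starSecular, limitSecular]

theorem tendsto_starSecular (hDL : D < L) {k : ℝ} (hk : 0 < k) :
    Filter.Tendsto (fun n : ℕ => starSecular L D n k) Filter.atTop
      (nhds (limitSecular L D k)) := by
  have hN : Filter.Tendsto (fun n : ℕ => (n : ℝ) - 1) Filter.atTop Filter.atTop :=
    Filter.tendsto_atTop_add_const_right _ _ tendsto_natCast_atTop_atTop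
  have hz : Filter.Tendsto (fun n : ℕ => (L - D) / ((n : ℝ) - 1)) Filter.atTop (nhds 0) :=
    hN.const_div_atTop _
  -- Through `sinc`, `(n - 1) sin (k (L - D) / (n - 1))` becomes `k (L - D)` times a factor tending
  -- to `sinc 0 = 1`.
  have hsinc : Filter.Tendsto
      (fun n : ℕ => k * (L - D) * Real.sinc (k * ((L - D) / ((n : ℝ) - 1)))) Filter.atTop
      (nhds (k * (L - D))) := by
    have := (Real.continuous_sinc.tendsto (k * 0)).comp (hz.const_mul k)
    simpa using this.const_mul (k * (L - D))
  have hsin : Filter.Tendsto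
      (fun n : ℕ => Real.sin (k * (D - (L - D) / ((n : ℝ) - 1)))) Filter.atTop
      (nhds (Real.sin (k * D))) := by
    have h := (Real.continuous_sin.tendsto (k * (D - 0))).comp ((hz.const_sub D).const_mul k)
    rwa [sub_zero] at h
  have h := (hsin.mul hsinc).const_sub (Real.cos (k * D))
  have e : limitSecular L D k =
      Real.cos (k * D) - Real.sin (k * D) * (k * (L - D)) := by
    rw [limitSecular]; ring
  rw [e]
  refine h.congr' ?_
  filter_upwards [Filter.eventually_ge_atTop 2] with n hn
  have h2 : (2 : ℝ) ≤ n := by exact_mod_cast hn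
  have hn1 : (0 : ℝ) < n - 1 := by linarith
  have e1 : (n * D - L) / ((n : ℝ) - 1) = D - (L - D) / (n - 1) := by
    field_simp; ring
  have ha1 : 0 < (L - D) / ((n : ℝ) - 1) := div_pos (by linarith) hn1
  have hne : k * ((L - D) / ((n : ℝ) - 1)) ≠ 0 := by positivity
  have hLD : L - D ≠ 0 := by linarith
  rw [starSecular, e1, Real.sinc_of_ne_zero hne]
  have : k * (L - D) * (Real.sin (k * ((L - D) / ((n : ℝ) - 1))) / (k * ((L - D) / (n - 1)))) =
      (n - 1) * Real.sin (k * ((L - D) / ((n : ℝ) - 1))) := by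
    generalize Real.sin (k * ((L - D) / ((n : ℝ) - 1))) = s
    field_simp
  rw [this]
  ring

theorem starFirstEigenvalue_lt_sq_iff (hD : 0 < D) (hDL : D ≤ L) (hn : 2 ≤ n) (hnD : L < n * D)
    {w : ℝ} (hw : w ∈ Set.Icc 0 (Real.pi / 2 / D)) :
    starFirstEigenvalue L D n < w ^ 2 ↔ starSecular L D n w < 0 := by
  obtain ⟨k, hk, hkb, hk0, he, -⟩ := starFirstEigenvalue_spec hD hDL hn hnD
  rw [he, ← hk0, sq_lt_sq₀ hk.le hw.1]
  exact ((strictAntiOn_starSecular hD hDL hn hnD).lt_iff_gt hw ⟨hk.le, hkb⟩).symm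

theorem sq_lt_starFirstEigenvalue_iff (hD : 0 < D) (hDL : D ≤ L) (hn : 2 ≤ n) (hnD : L < n * D)
    {w : ℝ} (hw : w ∈ Set.Icc 0 (Real.pi / 2 / D)) :
    w ^ 2 < starFirstEigenvalue L D n ↔ 0 < starSecular L D n w := by
  obtain ⟨k, hk, hkb, hk0, he, -⟩ := starFirstEigenvalue_spec hD hDL hn hnD
  rw [he, ← hk0, sq_lt_sq₀ hw.1 hk.le]
  exact ((strictAntiOn_starSecular hD hDL hn hnD).lt_iff_gt ⟨hk.le, hkb⟩ hw).symm

theorem starFirstEigenvalue_strictAntiOn (hD : 0 < D) (hDL : D < L) :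
    StrictAntiOn (fun n : ℕ => starFirstEigenvalue L D n) {n | 2 ≤ n ∧ L < n * D} := by
  intro n hn m hm hnm
  obtain ⟨k, hk, hkb, hk0, he, -⟩ := starFirstEigenvalue_spec hD hDL.le hn.1 hn.2
  dsimp only
  rw [he, starFirstEigenvalue_lt_sq_iff hD hDL.le hm.1 hm.2 ⟨hk.le, hkb⟩, ← hk0]
  exact starSecular_lt hD hDL hn.1 hn.2 hnm hk hkb

theorem limitRoot_sq_lt_starFirstEigenvalue (hD : 0 < D) (hDL : D < L) (hn : 2 ≤ n)
    (hnD : L < n * D) : limitRoot L D ^ 2 < starFirstEigenvalue L D n := by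
  obtain ⟨-, hb, h0⟩ := limitRoot_spec hD hDL.le
  have hp := limitRoot_pos hD hDL.le
  rw [sq_lt_starFirstEigenvalue_iff hD hDL.le hn hnD ⟨hp.le, hb⟩, ← h0]
  exact limitSecular_lt_starSecular hD hDL hn hnD hp hb

theorem starFirstEigenvalue_self (hD : 0 < D) (hDL : D = L) (hn : 2 ≤ n) :
    starFirstEigenvalue L D n = limitRoot L D ^ 2 := by
  have h2 : (2 : ℝ) ≤ n := by exact_mod_cast hn
  have hnD : L < n * D := by rw [← hDL]; nlinarith
  obtain ⟨-, hb, h0⟩ := limitRoot_spec hD hDL.le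
  have hp := limitRoot_pos hD hDL.le
  rw [← starSecular_self (n := n) hDL] at h0
  apply le_antisymm
  · rw [← not_lt, sq_lt_starFirstEigenvalue_iff hD hDL.le hn hnD ⟨hp.le, hb⟩, h0]
    exact lt_irrefl _
  · rw [← not_lt, starFirstEigenvalue_lt_sq_iff hD hDL.le hn hnD ⟨hp.le, hb⟩, h0]
    exact lt_irrefl _

theorem eventually_lt_natCast_mul (hD : 0 < D) : ∀ᶠ n : ℕ in Filter.atTop, L < n * D :=
  (tendsto_natCast_atTop_atTop.atTop_mul_const hD).eventually_gt_atTop L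

theorem tendsto_starFirstEigenvalue (hD : 0 < D) (hDL : D ≤ L) :
    Filter.Tendsto (fun n : ℕ => starFirstEigenvalue L D n) Filter.atTop
      (nhds (limitRoot L D ^ 2)) := by
  rcases hDL.lt_or_eq with h | h
  · have hp := limitRoot_pos hD hDL
    refine tendsto_order.2 ⟨fun a ha => ?_, fun a ha => ?_⟩
    · filter_upwards [Filter.eventually_ge_atTop 2, eventually_lt_natCast_mul hD] with n hn hnD
      exact ha.trans (limitRoot_sq_lt_starFirstEigenvalue hD h hn hnD)
    · have hb : 0 < Real.pi / 2 / D := by positivity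
      have hlt : limitRoot L D < Real.pi / 2 / D := by
        rw [limitRoot_lt_iff hD hDL ⟨hb.le, le_rfl⟩, limitSecular_pi_div hD, neg_lt_zero]
        exact mul_pos hb (sub_pos.2 h)
      -- At a `w` strictly above the root the limit function is negative, hence so is the star
      -- function for large `n`, which forces the eigenvalue below `w² < a`. Since `D < L`, the root
      -- is not the endpoint `π / (2 D)`, so there is room for such a `w`.
      obtain ⟨w, hw1, hw2⟩ := exists_between (lt_min hlt (Real.lt_sqrt_of_sq_lt ha))
      have hw0 : 0 < w := hp.trans hw1
      have hwb : w ∈ Set.Icc 0 (Real.pi / 2 / D) := ⟨hw0.le, (lt_min_iff.1 hw2).1.le⟩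
      have hwa : w ^ 2 < a := (Real.lt_sqrt hw0.le).1 (lt_min_iff.1 hw2).2
      filter_upwards [Filter.eventually_ge_atTop 2, eventually_lt_natCast_mul hD,
        (tendsto_starSecular h hw0).eventually_lt_const
          ((limitRoot_lt_iff hD hDL hwb).1 hw1)] with n hn hnD hneg
      exact ((starFirstEigenvalue_lt_sq_iff hD hDL hn hnD hwb).2 hneg).trans hwa
  · refine tendsto_const_nhds.congr' ?_
    filter_upwards [Filter.eventually_ge_atTop 2] with n hn
    exact (starFirstEigenvalue_self hD h hn).symm

end Star

/-! ### The interval problem with the second-order boundary condition. -/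

section Wentzell

variable {L D : ℝ}

theorem eq_left_of_hasDerivWithinAt_zero {f : ℝ → ℝ} (hD : 0 < D)
    (h : ∀ x ∈ Set.Icc 0 D, HasDerivWithinAt f 0 (Set.Icc 0 D) x) :
    ∀ x ∈ Set.Icc 0 D, f x = f 0 :=
  constant_of_derivWithin_zero (fun x hx => (h x hx).differentiableWithinAt) fun x hx =>
    (h x ⟨hx.1, hx.2.le⟩).derivWithin (uniqueDiffOn_Icc hD x ⟨hx.1, hx.2.le⟩)

theorem sq_limitRoot_mem_wentzellEigenvalues (hD : 0 < D) (hDL : D ≤ L) :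
    limitRoot L D ^ 2 ∈ wentzellEigenvalues L D := by
  obtain ⟨-, hb, h0⟩ := limitRoot_spec hD hDL
  have hp := limitRoot_pos hD hDL
  generalize limitRoot L D = w at *
  have hwD := (le_div_iff₀ hD).1 hb
  have h1 : ∀ x, HasDerivAt (fun x => w * x) (w * 1) x := fun x => (hasDerivAt_id x).const_mul w
  refine ⟨fun x => Real.sin (w * x), fun x => w * Real.cos (w * x),
    fun x => -(w ^ 2 * Real.sin (w * x)), fun x _ => ?_, fun x _ => ?_, by fun_prop,
    ⟨D, ⟨hD.le, le_rfl⟩, ?_⟩, fun x _ => by ring, by simp, ?_⟩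
  · exact ((h1 x).sin.congr_deriv (by ring)).hasDerivWithinAt
  · exact (((h1 x).cos.const_mul w).congr_deriv (by ring)).hasDerivWithinAt
  · exact (Real.sin_pos_of_pos_of_lt_pi (by positivity) (by linarith [Real.pi_pos])).ne'
  · unfold limitSecular at h0
    linear_combination w * h0

theorem sq_limitRoot_le_of_mem_wentzellEigenvalues (hD : 0 < D) (hDL : D ≤ L) {μ : ℝ}
    (hμ : μ ∈ wentzellEigenvalues L D) : limitRoot L D ^ 2 ≤ μ := by
  obtain ⟨u, u', u'', hu, hu', hc, ⟨x₀, hx₀, hne⟩, hode, hu0, hbc⟩ := hμ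
  have cu : ContinuousOn u (Set.Icc 0 D) := fun x hx => (hu x hx).continuousWithinAt
  have hDm : D ∈ Set.Icc 0 D := ⟨hD.le, le_rfl⟩
  -- By continuity of `u''` the equation holds up to `D`, so the boundary condition becomes `u'(D) =
  -- (L - D) μ u(D)`.
  have hode' : Set.EqOn u'' (fun x => -μ * u x) (Set.Icc 0 D) := by
    refine Set.EqOn.of_subset_closure (s := Set.Ioo 0 D) (fun x hx => ?_) hc
      (continuousOn_const.mul cu) Set.Ioo_subset_Icc_self (closure_Ioo hD.ne).ge
    have := hode x hx
    linarith
  have hbc' := hode' hDm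
  dsimp only at hbc'
  rcases le_or_gt μ 0 with hμ | hμ
  · exfalso
    -- For `μ ≤ 0`, `u u'` is nondecreasing, zero at `0` and at most `0` at `D`. Hence it vanishes,
    -- `u²` is constant, and `u = 0`.
    have hp : ∀ x ∈ Set.Icc 0 D,
        HasDerivWithinAt (fun x => u x * u' x) (u' x ^ 2 - μ * u x ^ 2) (Set.Icc 0 D) x := by
      intro x hx
      have := hode' hx
      dsimp only at this
      exact ((hu x hx).mul (hu' x hx)).congr_deriv (by rw [this]; ring)
    have hmono : MonotoneOn (fun x => u x * u' x) (Set.Icc 0 D) := by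
      refine monotoneOn_of_hasDerivWithinAt_nonneg (convex_Icc 0 D)
        (fun x hx => (hp x hx).continuousWithinAt)
        (fun x hx => (hp x (interior_subset hx)).mono interior_subset) (fun x _ => ?_)
      nlinarith [sq_nonneg (u' x), mul_nonneg (neg_nonneg.2 hμ) (sq_nonneg (u x))]
    have hend : u D * u' D ≤ 0 := by
      have h1 : u D * u' D = (L - D) * μ * u D ^ 2 := by
        rw [hbc'] at hbc
        linear_combination u D * hbc
      rw [h1]
      exact mul_nonpos_of_nonpos_of_nonneg
        (mul_nonpos_of_nonneg_of_nonpos (by linarith) hμ) (sq_nonneg _)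
    have hsq := eq_left_of_hasDerivWithinAt_zero hD (f := fun x => u x * u x) (fun x hx => by
      have l1 := hmono ⟨le_rfl, hD.le⟩ hx hx.1
      have l2 := hmono hx hDm hx.2
      simp only [hu0, zero_mul] at l1 l2
      exact ((hu x hx).mul (hu x hx)).congr_deriv (by linarith)) x₀ hx₀
    simp only [hu0, mul_zero, mul_self_eq_zero] at hsq
    exact hne hsq
  · obtain ⟨k, hk, rfl⟩ : ∃ k, 0 < k ∧ k ^ 2 = μ := ⟨√μ, Real.sqrt_pos.2 hμ, Real.sq_sqrt hμ.le⟩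
    obtain ⟨c, hcdef⟩ : ∃ c, c * k = u' 0 := ⟨u' 0 / k, div_mul_cancel₀ _ hk.ne'⟩
    have h1 : ∀ x, HasDerivAt (fun x => k * x) (k * 1) x := fun x =>
      (hasDerivAt_id x).const_mul k
    -- Uniqueness by conservation of energy: `u - c sin (k x)` solves the same equation, and `c` is
    -- chosen so that its data at `0` vanish.
    have hE : ∀ x ∈ Set.Icc 0 D, HasDerivWithinAt
        (fun x => (u' x - c * k * Real.cos (k * x)) ^ 2 + k ^ 2 * (u x - c * Real.sin (k * x)) ^ 2)
        0 (Set.Icc 0 D) x := by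
      intro x hx
      have := hode' hx
      dsimp only at this
      have a1 := (((hu' x hx).sub ((h1 x).cos.const_mul (c * k)).hasDerivWithinAt).pow 2)
      have a2 := (((hu x hx).sub ((h1 x).sin.const_mul c).hasDerivWithinAt).pow 2).const_mul (k ^ 2)
      refine (a1.add a2).congr_deriv ?_
      simp only [this, Pi.sub_apply]
      push_cast
      ring
    have hE0 : ∀ x ∈ Set.Icc 0 D, u' x = c * k * Real.cos (k * x) ∧ u x = c * Real.sin (k * x) := by
      intro x hx
      have := eq_left_of_hasDerivWithinAt_zero hD hE x hx
      simp only [mul_zero, Real.cos_zero, Real.sin_zero, mul_one, hcdef, sub_self, hu0] at this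
      rw [← hcdef] at this
      have e1 := sq_nonneg (u' x - c * k * Real.cos (k * x))
      have e2 := mul_nonneg (sq_nonneg k) (sq_nonneg (u x - c * Real.sin (k * x)))
      constructor
      · exact sub_eq_zero.1 (pow_eq_zero_iff two_ne_zero |>.1 (by linarith))
      · have : k ^ 2 * (u x - c * Real.sin (k * x)) ^ 2 = 0 := by linarith
        exact sub_eq_zero.1 (pow_eq_zero_iff two_ne_zero |>.1
          ((mul_eq_zero.1 this).resolve_left (by positivity)))
    have hc0 : c ≠ 0 := by
      rintro rfl
      exact hne (by rw [(hE0 x₀ hx₀).2, zero_mul])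
    have hroot : k ∈ limitRoots L D := by
      refine ⟨hk, ?_⟩
      rw [hbc', (hE0 D hDm).1, (hE0 D hDm).2] at hbc
      have : c * k ≠ 0 := mul_ne_zero hc0 hk.ne'
      apply mul_left_cancel₀ this
      linear_combination hbc
    have := (limitRoot_spec hD hDL).1.2 hroot
    exact pow_le_pow_left₀ (limitRoot_pos hD hDL).le this 2

end Wentzell

/-! ### Assembly of the main theorem. -/

theorem proposition1p4 (L : ℝ) (hL : 0 < L) :
    (∀ D ∈ Set.Ioc 0 L,
      -- the smallest positive root and the first eigenvalues exist
      IsLeast (limitRoots L D) (limitRoot L D) ∧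
      (∀ n : ℕ, 2 ≤ n → L < n * D →
        IsLeast (starEigenvalues L D n) (starFirstEigenvalue L D n)) ∧
      -- strict decrease in `n` and convergence from above
      (D < L → StrictAntiOn (fun n : ℕ => starFirstEigenvalue L D n) {n | 2 ≤ n ∧ L < n * D}) ∧
      Filter.Tendsto (fun n : ℕ => starFirstEigenvalue L D n) Filter.atTop
        (nhds (limitRoot L D ^ 2)) ∧
      (D < L → ∀ n : ℕ, 2 ≤ n → L < n * D → limitRoot L D ^ 2 < starFirstEigenvalue L D n) ∧
      (D = L → ∀ n : ℕ, 2 ≤ n → starFirstEigenvalue L D n = limitRoot L D ^ 2) ∧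
      -- the interval problem
      IsLeast (wentzellEigenvalues L D) (limitRoot L D ^ 2) ∧
      -- the two-sided bound
      1 / (L * D) < 1 / (L * D - D ^ 2 / 2) ∧
      1 / (L * D - D ^ 2 / 2) ≤ limitRoot L D ^ 2 ∧
      limitRoot L D ^ 2 ≤ 3 / (3 * L * D - 2 * D ^ 2) ∧
      (D < L → 3 / (3 * L * D - 2 * D ^ 2) < 3 / (L * D)) ∧
      limitRoot L D ^ 2 < 3 / (L * D)) ∧
    -- strict decrease in `D`
    StrictAntiOn (fun D : ℝ => limitRoot L D ^ 2) (Set.Ioc 0 L) := by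
  refine ⟨fun D ⟨hD, hDL⟩ => ?_, fun D₁ h1 D₂ h2 h12 =>
    pow_lt_pow_left₀ (limitRoot_strictAntiOn h1 h2 h12) (limitRoot_pos h2.1 h2.2).le two_ne_zero⟩
  obtain ⟨hroot, hb, -⟩ := limitRoot_spec hD hDL
  obtain ⟨hlo, hup⟩ := limitRoot_sq_bounds hD hDL
  have hLD : 0 < L * D := mul_pos hL hD
  have hD2 : 0 < D ^ 2 := pow_pos hD 2
  have hDLD : D ^ 2 ≤ L * D := by rw [sq]; exact mul_le_mul_of_nonneg_right hDL hD.le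
  have hup' : limitRoot L D ^ 2 ≤ 3 / (3 * L * D - 2 * D ^ 2) :=
    (le_div_iff₀ (by linarith)).2 hup
  have hstr : D < L → 3 / (3 * L * D - 2 * D ^ 2) < 3 / (L * D) := fun h =>
    div_lt_div_of_pos_left (by norm_num) hLD (by nlinarith [mul_lt_mul_of_pos_right h hD])
  refine ⟨hroot, fun n hn hnD => ?_, starFirstEigenvalue_strictAntiOn hD,
    tendsto_starFirstEigenvalue hD hDL, fun h n => limitRoot_sq_lt_starFirstEigenvalue hD h,
    fun h n => starFirstEigenvalue_self hD h,
    ⟨sq_limitRoot_mem_wentzellEigenvalues hD hDL,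
      fun μ => sq_limitRoot_le_of_mem_wentzellEigenvalues hD hDL⟩,
    one_div_lt_one_div_of_lt (by linarith) (by linarith),
    (div_le_iff₀ (by linarith)).2 hlo, hup', hstr, ?_⟩
  · obtain ⟨k, -, -, -, he, hl⟩ := starFirstEigenvalue_spec hD hDL hn hnD
    rwa [he]
  · rcases hDL.lt_or_eq with h | rfl
    · exact hup'.trans_lt (hstr h)
    -- For `D = L` the general upper bound equals `3 / (L D)`, so strictness comes from `ω D ≤ π /
    -- 2` and `π² / 4 < 3`.
    · rw [le_div_iff₀ hD] at hb
      have hp := mul_pos (limitRoot_pos hD hDL) hD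
      rw [lt_div_iff₀ hLD]
      nlinarith [Real.pi_lt_d2]
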